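/- Let $\alpha=(1+\sqrt5)/2$ be the golden ratio, let $F_n$ be the Fibonacci numbers ($F_0=0$, $F_1=1$, $F_n=F_{n-1}+F_{n-2}$ for $n\ge 2$) and let $L_n$ be the Lucas numbers ($L_0=2$, $L_1=1$, $L_n=L_{n-1}+L_{n-2}$ for $n\ge 2$). Let $r$ be a non-negative integer. If $r\neq 0$, then $$\sum_{k=1}^\infty \frac{(-1)^{k(r-1)}\left(\frac{27}{5}\right)^k}{k^2\binom{3k}{k}F_r^{2k}} = 6\arctan^2\!\left(\frac{\sqrt3}{2\sqrt[3]{\alpha^{2r}}+(-1)^r}\right)-\frac12\log^2\!\left(\frac{\sqrt5\,\alpha^rF_r}{\left(\sqrt[3]{\alpha^{2r}}-(-1)^r\right)^3}\right).$$ If $r\neq 1$, then $$\sum_{k=1}^\infty \frac{(-1)^{kr}27^k}{k^2\binom{3k}{k}L_r^{2k}} = 6\arctan^2\!\left(\frac{\sqrt3}{2\sqrt[3]{\alpha^{2r}}-(-1)^r}\right)-\frac12\log^2\!\left(\frac{\alpha^rL_r}{\left(\sqrt[3]{\alpha^{2r}}+(-1)^r\right)^3}\right).$$ Both series converge absolutely.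 -/

import Mathlib

/-- The Lucas numbers: `L 0 = 2`, `L 1 = 1`, `L (n + 2) = L (n + 1) + L n`. -/
def lucas : ℕ → ℕ
  | 0 => 2
  | 1 => 1
  | n + 2 => lucas (n + 1) + lucas n

/-! The substitution $z = 27w^3/(1+w^3)^2$ (`zArg`) uniformizes $S(z)=\sum_{k\ge1}
z^k/(k^2\binom{3k}{k})$. Applying $\frac{1+w^3}{3}\frac{d}{dw}$ once and then $\frac{d}{dw}$ twice
turns each term into a multiple of a difference of consecutive quantities (`hasDerivAt_term1'`).
Partial sums thus telescope to $\frac{18(1-w^3)}{(1+w^3)^2}$ times one minus a remainder. The same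
operator sends `closedForm` to exactly $\frac{18(1-w^3)}{(1+w^3)^2}$, and all the functions involved
vanish at $w=0$.

Integrating the remainder three times from $0$ bounds the error (`partialSum_error`). It tends to
$0$ for $|z|<27/4$, because $1/\binom{3k}{k}$ is at most $(4/27)^k$ up to a polynomial factor. The
endpoint $z=27/4$, $w=1$ follows by monotonicity (`hasSum_closedForm_one`).

The theorem is the case $w=s/x$ with $x=\alpha^{2r/3}$ and $s=\pm1$: Binet's formulas make $x^3+s$
equal to $\sqrt5\,\alpha^rF_r$ or $\alpha^rL_r$. Absolute convergence is contained in `HasSum`,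
which is unconditional over the reals. -/

/-! ### Growth of the binomial coefficients and convergence. -/

/-- The binomial coefficient `C(3n, n)` at `n = k + 1`. -/
noncomputable def tri (k : ℕ) : ℝ := (Nat.choose (3 * (k + 1)) (k + 1) : ℝ)

theorem tri_pos (k : ℕ) : 0 < tri k := by
  unfold tri
  exact_mod_cast Nat.choose_pos (by omega)

theorem tri_zero : tri 0 = 3 := by norm_num [tri]

theorem tri_succ (k : ℕ) :
    tri (k + 1) * (2 * (k + 2) * (2 * k + 3)) = tri k * (3 * (3 * k + 5) * (3 * k + 4)) := by
  have h1 := Nat.choose_mul_factorial_mul_factorial (show k + 1 ≤ 3 * (k + 1) by omega)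
  have h2 := Nat.choose_mul_factorial_mul_factorial (show k + 1 + 1 ≤ 3 * (k + 1 + 1) by omega)
  rw [show 3 * (k + 1) - (k + 1) = 2 * k + 2 by omega] at h1
  rw [show 3 * (k + 1 + 1) - (k + 1 + 1) = 2 * k + 2 + 1 + 1 by omega,
    show 3 * (k + 1 + 1) = 3 * (k + 1) + 1 + 1 + 1 by omega] at h2
  simp only [Nat.factorial_succ (3 * (k + 1) + 1 + 1), Nat.factorial_succ (3 * (k + 1) + 1),
    Nat.factorial_succ (3 * (k + 1)), Nat.factorial_succ (2 * k + 2 + 1),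
    Nat.factorial_succ (2 * k + 2), Nat.factorial_succ (k + 1)] at h2
  rw [← h1] at h2
  have h1' : (0 : ℝ) < ((k + 1).factorial : ℝ) * ((2 * k + 2).factorial : ℝ) := by positivity
  have h3 := congrArg (Nat.cast : ℕ → ℝ) h2
  push_cast at h3
  unfold tri
  rw [show 3 * (k + 1 + 1) = 3 * (k + 1) + 1 + 1 + 1 by omega]
  have h4 : (0 : ℝ) < (k + 2 : ℝ) := by positivity
  apply mul_right_cancel₀ (mul_pos h1' h4).ne'
  linear_combination h3

/-- The ratio of consecutive values of $(k+1)\binom{3k+3}{k+1}$ is at least its limit $27/4$; the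
factor $k+1$ compensates for the ratio of the binomials alone being smaller. -/
theorem tri_lower (k : ℕ) : 3 * (27 / 4 : ℝ) ^ k ≤ (k + 1) * tri k := by
  induction k with
  | zero => simp [tri_zero]
  | succ k ih =>
    have h := tri_succ k
    have hp := tri_pos k
    have hd : (0 : ℝ) < 2 * (k + 2) * (2 * k + 3) := by positivity
    have e : tri (k + 1) = tri k * (3 * (3 * k + 5) * (3 * k + 4)) / (2 * (k + 2) * (2 * k + 3)) := by
      rw [eq_div_iff hd.ne', h]
    rw [pow_succ, e]
    push_cast
    calc 3 * ((27 / 4 : ℝ) ^ k * (27 / 4)) ≤ (k + 1) * tri k * (27 / 4) := by linarith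
      _ ≤ _ := by
        rw [mul_div_assoc' (k + 1 + 1 : ℝ), le_div_iff₀ hd]
        have hk : (0 : ℝ) ≤ k := by positivity
        have : (k + 1 : ℝ) * (27 / 4) * (2 * (k + 2) * (2 * k + 3)) ≤
            (k + 1 + 1) * (3 * (3 * k + 5) * (3 * k + 4)) := by nlinarith [mul_nonneg hk hk]
        nlinarith [mul_le_mul_of_nonneg_left this hp.le]

/-- The coefficient of the telescoping remainder. -/
noncomputable def remCoeff (k : ℕ) : ℝ := 3 / 2 * (3 * k + 1) * (3 * k + 2) / ((k + 1) * tri k)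

theorem remCoeff_zero : remCoeff 0 = 1 := by norm_num [remCoeff, tri_zero]

/-- This second form of the coefficient makes the telescoping work: the thrice differentiated term
$k$ produces `remCoeff k` in the form of its definition and `remCoeff (k + 1)` in this one. -/
theorem remCoeff_succ (k : ℕ) : remCoeff (k + 1) = (2 * k + 3) / tri k := by
  have h := tri_succ k
  have h0 := (tri_pos k).ne'
  have h1 := (tri_pos (k + 1)).ne'
  unfold remCoeff
  push_cast
  rw [div_eq_div_iff (by positivity) h0]
  linear_combination -(1 / 2 : ℝ) * h

theorem remCoeff_nonneg (k : ℕ) : 0 ≤ remCoeff k := by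
  have := tri_pos k
  unfold remCoeff
  positivity

theorem inv_tri_le (k : ℕ) : 1 / tri k ≤ (k + 1) * (4 / 27 : ℝ) ^ k := by
  have h := tri_lower k
  have e : (27 / 4 : ℝ) ^ k * (4 / 27 : ℝ) ^ k = 1 := by rw [← mul_pow]; norm_num
  have h2 : (0 : ℝ) < (4 / 27 : ℝ) ^ k := by positivity
  rw [div_le_iff₀ (tri_pos k)]
  nlinarith [mul_le_mul_of_nonneg_right h h2.le]

theorem summable_quadratic_geometric {q : ℝ} (h0 : 0 ≤ q) (h1 : q < 1) :
    Summable fun k : ℕ => (2 * k + 3 : ℝ) * ((k + 1) * q ^ k) := by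
  have hn : ‖q‖ < 1 := by rwa [Real.norm_of_nonneg h0]
  have a0 := summable_geometric_of_lt_one h0 h1
  have a1 := summable_pow_mul_geometric_of_norm_lt_one 1 hn
  have a2 := summable_pow_mul_geometric_of_norm_lt_one 2 hn
  refine (((a2.mul_left 2).add (a1.mul_left 5)).add (a0.mul_left 3)).congr fun k => ?_
  ring

theorem summable_remCoeff {y : ℝ} (h0 : 0 ≤ y) (h1 : y < 27 / 4) :
    Summable fun k : ℕ => remCoeff (k + 1) * y ^ k := by
  have hs := summable_quadratic_geometric (q := 4 / 27 * y) (by positivity) (by linarith)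
  refine Summable.of_nonneg_of_le (fun k => mul_nonneg (remCoeff_nonneg _) (by positivity))
    (fun k => ?_) hs
  rw [remCoeff_succ, mul_pow, div_eq_mul_one_div]
  have := mul_le_mul_of_nonneg_left (inv_tri_le k)
    (show (0 : ℝ) ≤ (2 * k + 3) * y ^ k by positivity)
  nlinarith

theorem tendsto_remCoeff {y : ℝ} (h0 : 0 ≤ y) (h1 : y < 27 / 4) :
    Filter.Tendsto (fun k : ℕ => remCoeff k * y ^ k) Filter.atTop (nhds 0) := by
  rw [← Filter.tendsto_add_atTop_iff_nat 1]
  have := (summable_remCoeff h0 h1).tendsto_atTop_zero.mul_const y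
  rw [zero_mul] at this
  refine this.congr fun k => ?_
  ring

theorem summable_terms {y : ℝ} (h1 : |y| < 27 / 4) :
    Summable fun k : ℕ => y ^ (k + 1) / ((k + 1) ^ 2 * tri k) := by
  have hs := (summable_remCoeff (abs_nonneg y) h1).mul_right |y|
  refine Summable.of_norm_bounded hs fun k => ?_
  have hp := tri_pos k
  rw [Real.norm_eq_abs, abs_div, abs_pow, abs_of_pos (show (0 : ℝ) < (k + 1) ^ 2 * tri k by positivity),
    remCoeff_succ, pow_succ, div_mul_eq_mul_div, div_mul_eq_mul_div]
  have hk : (0 : ℝ) ≤ k := by positivity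
  apply div_le_div₀ (by positivity) _ hp
  · nlinarith [mul_pos hp (show (0 : ℝ) < (k + 1) ^ 2 by positivity), mul_nonneg hk hp.le, mul_nonneg (mul_nonneg hk hk) hp.le]
  · nlinarith [show (0 : ℝ) ≤ |y| ^ k * |y| by positivity, mul_nonneg hk (show (0 : ℝ) ≤ |y| ^ k * |y| by positivity)]

/-! ### The uniformizing substitution and the derivatives of one term. -/

/-- The substitution that uniformizes the series. -/
noncomputable def zArg (w : ℝ) : ℝ := 27 * w ^ 3 / (1 + w ^ 3) ^ 2

theorem hasDerivAt_zArg {w : ℝ} (hw : 1 + w ^ 3 ≠ 0) :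
    HasDerivAt zArg (81 * w ^ 2 * (1 - w ^ 3) / (1 + w ^ 3) ^ 3) w := by
  have h1 := (hasDerivAt_pow 3 w).const_mul 27
  have h2 := ((hasDerivAt_pow 3 w).const_add 1).pow 2
  refine (h1.div h2 (pow_ne_zero 2 hw)).congr_deriv ?_
  simp only [Pi.pow_apply]
  field_simp
  push_cast
  ring

/-- The derivative of `zArg w ^ (k + 1) / (k + 1)`, up to the factor `3 / (1 + w ^ 3)`. -/
noncomputable def term1 (k : ℕ) (w : ℝ) : ℝ :=
  27 ^ (k + 1) * w ^ (3 * k + 2) * (1 - w ^ 3) / (1 + w ^ 3) ^ (2 * k + 2)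

/-- The derivative of `term1 k`. -/
noncomputable def term1' (k : ℕ) (w : ℝ) : ℝ :=
  27 ^ (k + 1) * w ^ (3 * k + 1) *
    ((3 * k + 2) - (6 * k + 9) * w ^ 3 + (3 * k + 1) * w ^ 6) / (1 + w ^ 3) ^ (2 * k + 3)

theorem hasDerivAt_term1 (k : ℕ) {w : ℝ} (hw : 1 + w ^ 3 ≠ 0) :
    HasDerivAt (term1 k) (term1' k w) w := by
  have h1 := ((hasDerivAt_pow (3 * k + 2) w).const_mul (27 ^ (k + 1))).mul
    ((hasDerivAt_pow 3 w).const_sub 1)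
  have h2 := ((hasDerivAt_pow 3 w).const_add 1).pow (2 * k + 2)
  refine (h1.div h2 (pow_ne_zero _ hw)).congr_deriv ?_
  simp only [Pi.pow_apply, Pi.mul_apply, term1', show 3 * k + 2 - 1 = 3 * k + 1 by omega,
    show 2 * k + 2 - 1 = 2 * k + 1 by omega]
  rw [div_eq_div_iff (by positivity) (by positivity)]
  push_cast
  ring

/-- The numerator is a combination of $(1+w^3)^2$ and $w^3$, which correspond to `zArg w ^ k` and
`zArg w ^ (k + 1)`; this is the source of the telescoping. -/
theorem hasDerivAt_term1' (k : ℕ) {w : ℝ} (hw : 1 + w ^ 3 ≠ 0) :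
    HasDerivAt (term1' k) (((k + 1) * tri k) * (18 * (1 - w ^ 3) / (1 + w ^ 3) ^ 2 *
      (remCoeff k * zArg w ^ k - remCoeff (k + 1) * zArg w ^ (k + 1)))) w := by
  have h1 := ((hasDerivAt_pow (3 * k + 1) w).const_mul (27 ^ (k + 1))).mul
    ((((hasDerivAt_pow 3 w).const_mul (6 * k + 9 : ℝ)).const_sub (3 * k + 2 : ℝ)).add
      ((hasDerivAt_pow 6 w).const_mul (3 * k + 1 : ℝ)))
  have h2 := ((hasDerivAt_pow 3 w).const_add 1).pow (2 * k + 3)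
  refine (h1.div h2 (pow_ne_zero _ hw)).congr_deriv ?_
  have hp := (tri_pos k).ne'
  have hk : (k + 1 : ℝ) ≠ 0 := by positivity
  have e : ((k + 1) * tri k) * (18 * (1 - w ^ 3) / (1 + w ^ 3) ^ 2 *
      (remCoeff k * zArg w ^ k - remCoeff (k + 1) * zArg w ^ (k + 1))) =
      27 ^ (k + 1) * w ^ (3 * k) * (1 - w ^ 3) * ((3 * k + 1) * (3 * k + 2) * (1 + w ^ 3) ^ 2 -
        18 * (k + 1) * (2 * k + 3) * w ^ 3) / (1 + w ^ 3) ^ (2 * k + 4) := by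
    rw [remCoeff_succ, remCoeff, zArg, div_pow, div_pow, mul_pow, mul_pow, ← pow_mul, ← pow_mul,
      ← pow_mul, ← pow_mul, show 3 * (k + 1) = 3 * k + 3 by ring,
      show 2 * (k + 1) = 2 * k + 2 by ring]
    field_simp
    ring
  rw [e]
  simp only [Pi.pow_apply, Pi.mul_apply, Pi.add_apply, show 3 * k + 1 - 1 = 3 * k by omega,
    show 2 * k + 3 - 1 = 2 * k + 2 by omega]
  rw [div_eq_div_iff (by positivity) (by positivity)]
  push_cast
  ring

/-! ### The closed form and its differential equation. -/

section

open Filter Topology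

theorem one_add_cube_pos {w : ℝ} (h : -1 < w) : 0 < 1 + w ^ 3 := by
  have : 1 + w ^ 3 = (1 + w) * ((w - 1 / 2) ^ 2 + 3 / 4) := by ring
  rw [this]
  exact mul_pos (by linarith) (by positivity)

theorem quadratic_pos (w : ℝ) : 0 < 1 - w + w ^ 2 := by nlinarith [sq_nonneg (w - 1 / 2)]

/-- Up to constants, `atanPart` and `logPart` are the antiderivatives of $(1+w)/(1+w^3)$ and
$(w-1)/(1+w^3)$ that vanish at $0$. -/
noncomputable def atanPart (w : ℝ) : ℝ := Real.arctan (√3 * w / (2 - w))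

noncomputable def logPart (w : ℝ) : ℝ := Real.log ((1 - w + w ^ 2) / (1 + w) ^ 2)

theorem hasDerivAt_atanPart {w : ℝ} (h : w < 2) :
    HasDerivAt atanPart (√3 / 2 / (1 - w + w ^ 2)) w := by
  have h0 : 2 - w ≠ 0 := by linarith
  have h1 := ((hasDerivAt_id w).const_mul √3).div ((hasDerivAt_id w).const_sub 2) h0
  refine h1.arctan.congr_deriv ?_
  have hq := (quadratic_pos w).ne'
  have h3 : √3 ^ 2 = 3 := Real.sq_sqrt (by norm_num)
  simp only [id, Pi.div_apply]
  rw [div_pow, mul_pow, h3]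
  have : (2 - w) ^ 2 + 3 * w ^ 2 ≠ 0 := by nlinarith [quadratic_pos w]
  field_simp
  ring

theorem hasDerivAt_logPart {w : ℝ} (h : -1 < w) :
    HasDerivAt logPart (3 * (w - 1) / (1 + w ^ 3)) w := by
  have h0 : 1 + w ≠ 0 := by linarith
  have hq := (quadratic_pos w).ne'
  have h1 := ((((hasDerivAt_id w).const_sub 1).add (hasDerivAt_pow 2 w))).div
    (((hasDerivAt_id w).const_add 1).pow 2) (pow_ne_zero 2 h0)
  refine (h1.log (div_ne_zero hq (pow_ne_zero 2 h0))).congr_deriv ?_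
  have hc : 1 + w ^ 3 = (1 + w) * (1 - w + w ^ 2) := by ring
  simp only [id, Pi.div_apply, Pi.add_apply, Pi.pow_apply]
  rw [hc]
  field_simp
  push_cast
  ring

/-- The sum of the series at `zArg w`. -/
noncomputable def closedForm (w : ℝ) : ℝ := 6 * atanPart w ^ 2 - 1 / 2 * logPart w ^ 2

/-- The derivative of `closedForm`, up to the factor `3 / (1 + w ^ 3)`. -/
noncomputable def closedForm1 (w : ℝ) : ℝ :=
  2 * √3 * (1 + w) * atanPart w + (1 - w) * logPart w

/-- The derivative of `closedForm1`. -/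
noncomputable def closedForm2 (w : ℝ) : ℝ :=
  2 * √3 * atanPart w - logPart w + 12 * w / (1 + w ^ 3)

theorem hasDerivAt_closedForm {w : ℝ} (h : -1 < w) (h2 : w < 2) :
    HasDerivAt closedForm (3 / (1 + w ^ 3) * closedForm1 w) w := by
  have h1 := (((hasDerivAt_atanPart h2).pow 2).const_mul 6).sub
    (((hasDerivAt_logPart h).pow 2).const_mul (1 / 2))
  refine h1.congr_deriv ?_
  have h0 : 1 + w ≠ 0 := by linarith
  have hq := (quadratic_pos w).ne'
  have hc : 1 + w ^ 3 = (1 + w) * (1 - w + w ^ 2) := by ring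
  rw [closedForm1, hc]
  field_simp
  push_cast
  ring

theorem hasDerivAt_closedForm1 {w : ℝ} (h : -1 < w) (h2 : w < 2) :
    HasDerivAt closedForm1 (closedForm2 w) w := by
  have h1 := ((((hasDerivAt_id w).const_add 1).const_mul (2 * √3)).mul
    (hasDerivAt_atanPart h2)).add (((hasDerivAt_id w).const_sub 1).mul (hasDerivAt_logPart h))
  refine h1.congr_deriv ?_
  have h0 : 1 + w ≠ 0 := by linarith
  have hq := (quadratic_pos w).ne'
  have hc : 1 + w ^ 3 = (1 + w) * (1 - w + w ^ 2) := by ring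
  have h3 : √3 ^ 2 = 3 := Real.sq_sqrt (by norm_num)
  simp only [id]
  rw [closedForm2, hc]
  field_simp
  linear_combination (1 + w) ^ 2 * h3

theorem hasDerivAt_closedForm2 {w : ℝ} (h : -1 < w) (h2 : w < 2) :
    HasDerivAt closedForm2 (18 * (1 - w ^ 3) / (1 + w ^ 3) ^ 2) w := by
  have hc0 := (one_add_cube_pos h).ne'
  have h1 := (((hasDerivAt_atanPart h2).const_mul (2 * √3)).sub (hasDerivAt_logPart h)).add
    (((hasDerivAt_id w).const_mul 12).div ((hasDerivAt_pow 3 w).const_add 1) hc0)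
  refine h1.congr_deriv ?_
  have h0 : 1 + w ≠ 0 := by linarith
  have hq := (quadratic_pos w).ne'
  have hc : 1 + w ^ 3 = (1 + w) * (1 - w + w ^ 2) := by ring
  have h3 : √3 * √3 = 3 := Real.mul_self_sqrt (by norm_num)
  have e : 2 * √3 * (√3 / 2 / (1 - w + w ^ 2)) = 3 / (1 - w + w ^ 2) := by
    rw [show 2 * √3 * (√3 / 2 / (1 - w + w ^ 2)) = √3 * √3 / (1 - w + w ^ 2) by ring, h3]
  simp only [id]
  rw [e, hc]
  field_simp
  push_cast
  ring

/-! ### Partial sums and telescoping. -/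

noncomputable def partialSum (N : ℕ) (w : ℝ) : ℝ :=
  ∑ k ∈ Finset.range N, zArg w ^ (k + 1) / ((k + 1) ^ 2 * tri k)

noncomputable def partialSum1 (N : ℕ) (w : ℝ) : ℝ :=
  ∑ k ∈ Finset.range N, term1 k w / ((k + 1) * tri k)

noncomputable def partialSum2 (N : ℕ) (w : ℝ) : ℝ :=
  ∑ k ∈ Finset.range N, term1' k w / ((k + 1) * tri k)

theorem hasDerivAt_partialSum (N : ℕ) {w : ℝ} (hw : 1 + w ^ 3 ≠ 0) :
    HasDerivAt (partialSum N) (3 / (1 + w ^ 3) * partialSum1 N w) w := by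
  unfold partialSum partialSum1
  rw [Finset.mul_sum]
  refine HasDerivAt.fun_sum fun k _ => ?_
  refine (((hasDerivAt_zArg hw).pow (k + 1)).div_const _).congr_deriv ?_
  have hp := (tri_pos k).ne'
  have hk : (k + 1 : ℝ) ≠ 0 := by positivity
  rw [term1, zArg, show k + 1 - 1 = k by omega, div_pow, mul_pow, ← pow_mul, ← pow_mul]
  field_simp
  push_cast
  ring

theorem hasDerivAt_partialSum1 (N : ℕ) {w : ℝ} (hw : 1 + w ^ 3 ≠ 0) :
    HasDerivAt (partialSum1 N) (partialSum2 N w) w :=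
  HasDerivAt.fun_sum fun k _ => (hasDerivAt_term1 k hw).div_const _

theorem hasDerivAt_partialSum2 (N : ℕ) {w : ℝ} (hw : 1 + w ^ 3 ≠ 0) :
    HasDerivAt (partialSum2 N)
      (18 * (1 - w ^ 3) / (1 + w ^ 3) ^ 2 * (1 - remCoeff N * zArg w ^ N)) w := by
  have h : HasDerivAt (partialSum2 N) (∑ k ∈ Finset.range N, _) w :=
    HasDerivAt.fun_sum fun k _ => (hasDerivAt_term1' k hw).div_const ((k + 1) * tri k)
  refine h.congr_deriv ?_
  have e : ∀ k ∈ Finset.range N, ((k + 1) * tri k) * (18 * (1 - w ^ 3) / (1 + w ^ 3) ^ 2 *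
      (remCoeff k * zArg w ^ k - remCoeff (k + 1) * zArg w ^ (k + 1))) / ((k + 1) * tri k) =
      18 * (1 - w ^ 3) / (1 + w ^ 3) ^ 2 *
        (remCoeff k * zArg w ^ k - remCoeff (k + 1) * zArg w ^ (k + 1)) := fun k _ => by
    have := tri_pos k
    exact mul_div_cancel_left₀ _ (by positivity)
  rw [Finset.sum_congr rfl e, ← Finset.mul_sum,
    Finset.sum_range_sub' (fun k => remCoeff k * zArg w ^ k), remCoeff_zero]
  simp

/-! ### The error estimate on $|w|<1$. -/

/-- Mean value inequality on a segment of length at most $1$: the bound passes from derivative to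
function without loss, so it can be iterated. -/
theorem abs_le_of_abs_deriv_le {f f' : ℝ → ℝ} {v C : ℝ} (hv : |v| ≤ 1) (hC : 0 ≤ C)
    (h0 : f 0 = 0) (hf : ∀ w ∈ Set.uIcc 0 v, HasDerivAt f (f' w) w)
    (hb : ∀ w ∈ Set.uIcc 0 v, |f' w| ≤ C) : ∀ w ∈ Set.uIcc 0 v, |f w| ≤ C := by
  intro w hw
  have h := (convex_uIcc (0 : ℝ) v).norm_image_sub_le_of_norm_hasDerivWithin_le
    (fun x hx => (hf x hx).hasDerivWithinAt) hb Set.left_mem_uIcc hw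
  rw [h0, sub_zero, sub_zero, Real.norm_eq_abs, Real.norm_eq_abs] at h
  have hw1 : |w| ≤ 1 := by
    have := Set.abs_sub_left_of_mem_uIcc hw
    simp only [sub_zero] at this
    linarith
  nlinarith

theorem abs_le_of_mem_uIcc_zero {v w : ℝ} (hw : w ∈ Set.uIcc 0 v) : |w| ≤ |v| := by
  simpa using Set.abs_sub_left_of_mem_uIcc hw

/-- Makes the remainder at the endpoint `v` control the remainder on the whole segment from $0$. -/
theorem abs_zArg_le {v w : ℝ} (hv : |v| < 1) (hw : w ∈ Set.uIcc 0 v) : |zArg w| ≤ |zArg v| := by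
  have h1 := abs_le_of_mem_uIcc_zero hw
  have pv := one_add_cube_pos (abs_lt.1 hv).1
  have pw := one_add_cube_pos (abs_lt.1 (h1.trans_lt hv)).1
  -- Here $p=|w|^3$, $q=|v|^3$ and $s$ is the sign of $v$, so that $1+sq=1+v^3$ and $1+sp=1+w^3$.
  have key : ∀ p q : ℝ, 0 ≤ p → p ≤ q → q < 1 → ∀ s : ℝ, s ^ 2 = 1 →
      p * (1 + s * q) ^ 2 ≤ q * (1 + s * p) ^ 2 := by
    intro p q hp hpq hq s hs
    have : q * (1 + s * p) ^ 2 - p * (1 + s * q) ^ 2 = (q - p) * (1 - p * q) := by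
      linear_combination (q * p ^ 2 - p * q ^ 2) * hs
    nlinarith [mul_nonneg (sub_nonneg.2 hpq) (show 0 ≤ 1 - p * q by nlinarith)]
  unfold zArg
  rw [abs_div, abs_div, abs_of_pos (pow_pos pv 2), abs_of_pos (pow_pos pw 2),
    div_le_div_iff₀ (pow_pos pw 2) (pow_pos pv 2), abs_mul, abs_mul, abs_pow, abs_pow]
  have hq : |v| ^ 3 < 1 := pow_lt_one₀ (abs_nonneg v) hv (by norm_num)
  have hpq : |w| ^ 3 ≤ |v| ^ 3 := pow_le_pow_left₀ (abs_nonneg w) h1 3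
  have hp : 0 ≤ |w| ^ 3 := by positivity
  rcases le_total 0 v with h | h
  · rw [Set.uIcc_of_le h] at hw
    have := key _ _ hp hpq hq 1 (by norm_num)
    rw [one_mul, one_mul, abs_of_nonneg h, abs_of_nonneg hw.1] at this
    rw [abs_of_nonneg h, abs_of_nonneg hw.1, abs_of_pos (by norm_num : (0 : ℝ) < 27)]
    linarith
  · rw [Set.uIcc_of_ge h] at hw
    have := key _ _ hp hpq hq (-1) (by norm_num)
    rw [abs_of_nonpos h, abs_of_nonpos hw.2] at this
    rw [abs_of_nonpos h, abs_of_nonpos hw.2, abs_of_pos (by norm_num : (0 : ℝ) < 27)]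
    have e1 : 1 + -1 * (-v) ^ 3 = 1 + v ^ 3 := by ring
    have e2 : 1 + -1 * (-w) ^ 3 = 1 + w ^ 3 := by ring
    rw [e1, e2] at this
    linarith

/-- The factor $36=18\cdot2$ comes from $|1-w^3|\le2$, and the powers of $1-|v|^3$ from
$1+w^3\ge1-|v|^3$ on the segment. -/
theorem partialSum_error (N : ℕ) {v : ℝ} (hv : |v| < 1) :
    |partialSum N v - closedForm v| ≤
      3 / (1 - |v| ^ 3) * (36 / (1 - |v| ^ 3) ^ 2 * (remCoeff N * |zArg v| ^ N)) := by
  set m := 1 - |v| ^ 3 with hm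
  have hm0 : 0 < m := by
    have := pow_lt_one₀ (abs_nonneg v) hv (show 3 ≠ 0 by norm_num)
    linarith
  have hd : 0 ≤ remCoeff N * |zArg v| ^ N := mul_nonneg (remCoeff_nonneg N) (by positivity)
  set d := remCoeff N * |zArg v| ^ N with hdd
  have mem : ∀ w ∈ Set.uIcc 0 v, -1 < w ∧ w < 2 ∧ m ≤ 1 + w ^ 3 ∧ |1 - w ^ 3| ≤ 2 := by
    intro w hw
    have h1 := abs_le_of_mem_uIcc_zero hw
    have h2 := abs_lt.1 (h1.trans_lt hv)
    have h3 : |w ^ 3| ≤ |v| ^ 3 := by rw [abs_pow]; exact pow_le_pow_left₀ (abs_nonneg w) h1 3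
    have h4 := abs_le.1 h3
    refine ⟨h2.1, by linarith [h2.2], by linarith [h4.1], abs_le.2 ⟨?_, ?_⟩⟩ <;> linarith [h4.1, h4.2]
  have hC : 0 ≤ 36 / m ^ 2 * d := by positivity
  have s2 : ∀ w ∈ Set.uIcc 0 v, |partialSum2 N w - closedForm2 w| ≤ 36 / m ^ 2 * d := by
    refine abs_le_of_abs_deriv_le hv.le hC ?_ (fun w hw => (hasDerivAt_partialSum2 N
      (hm0.trans_le (mem w hw).2.2.1).ne').sub (hasDerivAt_closedForm2 (mem w hw).1 (mem w hw).2.1))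
      fun w hw => ?_
    · simp [partialSum2, closedForm2, term1', atanPart, logPart]
    · obtain ⟨h1, h2, h3, h4⟩ := mem w hw
      have hz : |zArg w| ^ N ≤ |zArg v| ^ N :=
        pow_le_pow_left₀ (abs_nonneg _) (abs_zArg_le hv hw) N
      have e : 18 * (1 - w ^ 3) / (1 + w ^ 3) ^ 2 * (1 - remCoeff N * zArg w ^ N) -
          18 * (1 - w ^ 3) / (1 + w ^ 3) ^ 2 =
          -(18 * (1 - w ^ 3) / (1 + w ^ 3) ^ 2 * (remCoeff N * zArg w ^ N)) := by ring
      have hp : 0 < 1 + w ^ 3 := hm0.trans_le h3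
      rw [e, abs_neg, abs_mul, abs_div, abs_mul, abs_mul, abs_pow, abs_pow, abs_of_pos hp,
        abs_of_nonneg (remCoeff_nonneg N), abs_of_pos (by norm_num : (0 : ℝ) < 18)]
      gcongr
      · exact mul_nonneg (remCoeff_nonneg N) (by positivity)
      · linarith
      · exact mul_le_mul_of_nonneg_left hz (remCoeff_nonneg N)
  have s1 : ∀ w ∈ Set.uIcc 0 v, |partialSum1 N w - closedForm1 w| ≤ 36 / m ^ 2 * d := by
    refine abs_le_of_abs_deriv_le hv.le hC ?_ (fun w hw => (hasDerivAt_partialSum1 N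
      (hm0.trans_le (mem w hw).2.2.1).ne').sub (hasDerivAt_closedForm1 (mem w hw).1 (mem w hw).2.1))
      s2
    simp [partialSum1, closedForm1, term1, atanPart, logPart]
  refine abs_le_of_abs_deriv_le hv.le (by positivity) ?_ (fun w hw => (hasDerivAt_partialSum N
      (hm0.trans_le (mem w hw).2.2.1).ne').sub (hasDerivAt_closedForm (mem w hw).1 (mem w hw).2.1))
      (fun w hw => ?_) v Set.right_mem_uIcc
  · simp [partialSum, closedForm, zArg, atanPart, logPart]
  · have h3 := (mem w hw).2.2.1
    rw [← mul_sub, abs_mul, abs_of_pos (div_pos (by norm_num) (hm0.trans_le h3))]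
    have := s1 w hw
    gcongr

theorem hasSum_closedForm {v : ℝ} (hv : |v| < 1) (hz : |zArg v| < 27 / 4) :
    HasSum (fun k : ℕ => zArg v ^ (k + 1) / ((k + 1) ^ 2 * tri k)) (closedForm v) := by
  rw [(summable_terms hz).hasSum_iff_tendsto_nat, tendsto_iff_norm_sub_tendsto_zero]
  have h := ((tendsto_remCoeff (abs_nonneg _) hz).const_mul (36 / (1 - |v| ^ 3) ^ 2)).const_mul
    (3 / (1 - |v| ^ 3))
  rw [mul_zero, mul_zero] at h
  exact squeeze_zero (fun _ => norm_nonneg _) (fun N => partialSum_error N hv) h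

theorem zArg_nonneg {v : ℝ} (h : 0 ≤ v) : 0 ≤ zArg v := by unfold zArg; positivity

theorem zArg_lt {v : ℝ} (h0 : 0 ≤ v) (h1 : v < 1) : zArg v < 27 / 4 := by
  have hq : v ^ 3 < 1 := pow_lt_one₀ h0 h1 (by norm_num)
  unfold zArg
  rw [div_lt_div_iff₀ (by positivity) (by norm_num)]
  nlinarith [mul_pos (sub_pos.2 hq) (sub_pos.2 hq)]

/-! ### The boundary point $w=1$. -/

theorem hasSum_closedForm_one :
    HasSum (fun k : ℕ => zArg 1 ^ (k + 1) / ((k + 1) ^ 2 * tri k)) (closedForm 1) := by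
  have hne : 1 + (1 : ℝ) ^ 3 ≠ 0 := by norm_num
  have hz : ContinuousAt zArg 1 := (hasDerivAt_zArg hne).continuousAt
  have hG : Tendsto closedForm (𝓝[<] 1) (𝓝 (closedForm 1)) :=
    (hasDerivAt_closedForm (by norm_num) (by norm_num)).continuousAt.tendsto.mono_left
      nhdsWithin_le_nhds
  have hpos : ∀ v : ℝ, 0 ≤ v → ∀ k : ℕ, 0 ≤ zArg v ^ (k + 1) / ((k + 1) ^ 2 * tri k) := by
    intro v hv k
    have h1 := zArg_nonneg hv
    have h2 := tri_pos k
    positivity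
  have hev : ∀ᶠ v in 𝓝[<] (1 : ℝ), v ∈ Set.Ioo (0 : ℝ) 1 := Ioo_mem_nhdsLT (by norm_num)
  have hsum : ∀ v ∈ Set.Ioo (0 : ℝ) 1,
      HasSum (fun k : ℕ => zArg v ^ (k + 1) / ((k + 1) ^ 2 * tri k)) (closedForm v) := by
    intro v hv
    refine hasSum_closedForm (by rw [abs_of_pos hv.1]; exact hv.2) ?_
    rw [abs_of_nonneg (zArg_nonneg hv.1.le)]
    exact zArg_lt hv.1.le hv.2
  -- With nonnegative terms the sum is the supremum of the finite sums. Finite sums at $1$ are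
  -- limits of finite sums at $v<1$, which `closedForm v` bounds; conversely, any upper bound at $1$
  -- bounds `closedForm v`, since `zArg v ≤ zArg 1`.
  refine hasSum_of_isLUB_of_nonneg _ (hpos 1 zero_le_one) ⟨?_, ?_⟩
  · rintro _ ⟨s, rfl⟩
    have hc : Tendsto (fun v => ∑ k ∈ s, zArg v ^ (k + 1) / ((k + 1) ^ 2 * tri k)) (𝓝[<] 1)
        (𝓝 (∑ k ∈ s, zArg 1 ^ (k + 1) / ((k + 1) ^ 2 * tri k))) :=
      tendsto_finsetSum _ fun k _ =>
        ((hz.tendsto.mono_left nhdsWithin_le_nhds).pow (k + 1)).div_const _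
    refine le_of_tendsto_of_tendsto hc hG ?_
    filter_upwards [hev] with v hv
    exact sum_le_hasSum s (fun k _ => hpos v hv.1.le k) (hsum v hv)
  · intro b hb
    refine le_of_tendsto hG ?_
    filter_upwards [hev] with v hv
    refine hasSum_le_of_sum_le (hsum v hv) fun s => le_trans ?_ (hb ⟨s, rfl⟩)
    refine Finset.sum_le_sum fun k _ => ?_
    have h2 := tri_pos k
    have h1 : zArg v ≤ zArg 1 := by
      have := zArg_lt hv.1.le hv.2
      norm_num [zArg] at this ⊢
      exact this.le
    have h0 := zArg_nonneg hv.1.le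
    gcongr

end

/-! ### Passage to $w=s/x$. -/

theorem hasSum_of_uniformizer {x s Z : ℝ} (hs : s = 1 ∨ s = -1)
    (hZ : Z = 27 * s * x ^ 3 / (x ^ 3 + s) ^ 2) (h : (x = 1 ∧ s = 1) ∨ (1 < x ∧ |Z| < 27 / 4)) :
    HasSum (fun k : ℕ => Z ^ (k + 1) / ((k + 1) ^ 2 * tri k))
      (6 * Real.arctan (√3 / (2 * x - s)) ^ 2
        - 1 / 2 * Real.log ((x ^ 3 + s) / (x + s) ^ 3) ^ 2) := by
  have hx : 0 < x := by rcases h with h | h <;> linarith [h.1]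
  have hxs : 0 < x + s := by rcases h with h | h <;> rcases hs with hs | hs <;> linarith [h.1]
  have hxs2 : 0 < 2 * x - s := by rcases h with h | h <;> rcases hs with hs | hs <;> linarith [h.1]
  have hss : s ^ 2 = 1 := by rcases hs with rfl | rfl <;> norm_num
  have hq : 0 < x ^ 2 - s * x + 1 := by nlinarith [sq_nonneg (x - s / 2)]
  have hcube : x ^ 3 + s = (x + s) * (x ^ 2 - s * x + 1) := by
    linear_combination x * hss
  have hz : zArg (s / x) = Z := by
    have h0 : x ^ 3 + s ≠ 0 := by rw [hcube]; positivity
    have h1 : 1 + (s / x) ^ 3 = (x ^ 3 + s) / x ^ 3 := by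
      field_simp
      linear_combination s * hss
    rw [hZ, zArg, h1]
    field_simp
    linear_combination s * hss
  -- The sign $s$ leaves the arctangent by oddness and disappears on squaring.
  have ha : atanPart (s / x) ^ 2 = Real.arctan (√3 / (2 * x - s)) ^ 2 := by
    have e : √3 * (s / x) / (2 - s / x) = s * (√3 / (2 * x - s)) := by
      have : 2 - s / x = (2 * x - s) / x := by field_simp
      rw [this]
      field_simp
    rw [atanPart, e]
    rcases hs with rfl | rfl
    · rw [one_mul]
    · rw [neg_one_mul, Real.arctan_neg, neg_sq]
  have hl : logPart (s / x) = Real.log ((x ^ 3 + s) / (x + s) ^ 3) := by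
    have e1 : 1 - s / x + (s / x) ^ 2 = (x ^ 2 - s * x + 1) / x ^ 2 := by
      field_simp
      linear_combination hss
    have e2 : 1 + s / x = (x + s) / x := by field_simp
    rw [logPart, hcube, e1, e2]
    congr 1
    field_simp
  have hG : closedForm (s / x) = 6 * Real.arctan (√3 / (2 * x - s)) ^ 2
      - 1 / 2 * Real.log ((x ^ 3 + s) / (x + s) ^ 3) ^ 2 := by rw [closedForm, ha, hl]
  rw [← hz, ← hG]
  rcases h with ⟨rfl, rfl⟩ | ⟨h1, h2⟩
  · rw [div_one]
    exact hasSum_closedForm_one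
  · refine hasSum_closedForm ?_ (by rwa [hz])
    rw [abs_div, abs_of_pos hx, div_lt_one hx]
    rcases hs with rfl | rfl <;> simpa

/-! ### Fibonacci and Lucas numbers, and the two evaluations. -/

theorem lucas_eq (r : ℕ) : (lucas r : ℝ) = Real.goldenRatio ^ r + Real.goldenConj ^ r := by
  induction r using Nat.twoStepInduction with
  | zero => norm_num [lucas]
  | one => simp [lucas]
  | more n h0 h1 =>
    rw [lucas, Nat.cast_add, h0, h1]
    linear_combination -Real.goldenRatio ^ n * Real.goldenRatio_sq
      - Real.goldenConj ^ n * Real.goldenConj_sq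

theorem one_le_lucas (r : ℕ) : 1 ≤ lucas r := by
  induction r using Nat.twoStepInduction with
  | zero => simp [lucas]
  | one => simp [lucas]
  | more n h0 h1 => rw [lucas]; omega

theorem three_le_lucas (r : ℕ) : 3 ≤ lucas (r + 2) := by
  cases r with
  | zero => simp [lucas]
  | succ n =>
    have h1 := one_le_lucas n
    have h2 := one_le_lucas (n + 1)
    simp only [lucas] at h2 ⊢
    omega

theorem goldenRatio_pow_mul_lucas (r : ℕ) :
    Real.goldenRatio ^ r * (lucas r : ℝ) = Real.goldenRatio ^ (2 * r) + (-1) ^ r := by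
  rw [lucas_eq, ← Real.goldenRatio_mul_goldenConj, mul_pow]
  ring

theorem sqrt_five_mul_goldenRatio_pow_mul_fib (r : ℕ) :
    √5 * Real.goldenRatio ^ r * (Nat.fib r : ℝ) = Real.goldenRatio ^ (2 * r) + -(-1) ^ r := by
  have h5 : √5 ≠ 0 := by positivity
  rw [Real.coe_fib_eq, ← Real.goldenRatio_mul_goldenConj, mul_pow]
  field_simp
  ring

theorem cube_goldenRatio_rpow (r : ℕ) :
    ((Real.goldenRatio ^ (2 * r)) ^ (1 / 3 : ℝ)) ^ 3 = Real.goldenRatio ^ (2 * r) := by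
  have h : 0 ≤ Real.goldenRatio ^ (2 * r) := pow_nonneg Real.goldenRatio_pos.le _
  rw [← Real.rpow_natCast, ← Real.rpow_mul h]
  norm_num

theorem one_lt_goldenRatio_rpow {r : ℕ} (hr : r ≠ 0) :
    1 < (Real.goldenRatio ^ (2 * r)) ^ (1 / 3 : ℝ) :=
  Real.one_lt_rpow (one_lt_pow₀ Real.one_lt_goldenRatio (by omega)) (by norm_num)

/-- The summation index `k ≥ 1` is written as `k + 1` with `k : ℕ`; the cube root is taken only of
the positive real `α ^ (2 * r)`, where `α` is Mathlib's golden ratio. -/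
theorem theorem1 (r : ℕ) :
    (r ≠ 0 →
      HasSum
        (fun k : ℕ =>
          ((-1 : ℝ) ^ (((k : ℤ) + 1) * ((r : ℤ) - 1)) * (27 / 5 : ℝ) ^ (k + 1)) /
            (((k : ℝ) + 1) ^ 2 * (Nat.choose (3 * (k + 1)) (k + 1) : ℝ) *
              (Nat.fib r : ℝ) ^ (2 * (k + 1))))
        (6 * Real.arctan
            (Real.sqrt 3 /
              (2 * (Real.goldenRatio ^ (2 * r)) ^ (1 / 3 : ℝ) + (-1 : ℝ) ^ r)) ^ 2
          - 1 / 2 * Real.log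
            (Real.sqrt 5 * Real.goldenRatio ^ r * (Nat.fib r : ℝ) /
              ((Real.goldenRatio ^ (2 * r)) ^ (1 / 3 : ℝ) - (-1 : ℝ) ^ r) ^ 3) ^ 2)) ∧
    (r ≠ 1 →
      HasSum
        (fun k : ℕ =>
          ((-1 : ℝ) ^ ((k + 1) * r) * (27 : ℝ) ^ (k + 1)) /
            (((k : ℝ) + 1) ^ 2 * (Nat.choose (3 * (k + 1)) (k + 1) : ℝ) *
              (lucas r : ℝ) ^ (2 * (k + 1))))
        (6 * Real.arctan
            (Real.sqrt 3 /
              (2 * (Real.goldenRatio ^ (2 * r)) ^ (1 / 3 : ℝ) - (-1 : ℝ) ^ r)) ^ 2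
          - 1 / 2 * Real.log
            (Real.goldenRatio ^ r * (lucas r : ℝ) /
              ((Real.goldenRatio ^ (2 * r)) ^ (1 / 3 : ℝ) + (-1 : ℝ) ^ r) ^ 3) ^ 2)) := by

  have hcube := cube_goldenRatio_rpow r
  have hone := @one_lt_goldenRatio_rpow r
  have hzero : r = 0 → (Real.goldenRatio ^ (2 * r)) ^ (1 / 3 : ℝ) = 1 := by
    rintro rfl
    simp
  have hphi : Real.goldenRatio ^ r ≠ 0 := pow_ne_zero _ Real.goldenRatio_pos.ne'
  set x := (Real.goldenRatio ^ (2 * r)) ^ (1 / 3 : ℝ) with hx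
  have hsq : x ^ 3 = (Real.goldenRatio ^ r) ^ 2 := by rw [hcube, ← pow_mul, mul_comm]
  have habs : |(-1 : ℝ) ^ r| = 1 := by rw [abs_pow, abs_neg, abs_one, one_pow]
  constructor
  · intro hr
    have hF : (1 : ℝ) ≤ Nat.fib r := by exact_mod_cast Nat.fib_pos.2 (Nat.pos_of_ne_zero hr)
    have hfib := sqrt_five_mul_goldenRatio_pow_mul_fib r
    rw [← hcube] at hfib
    have h5 : √5 ^ 2 = 5 := Real.sq_sqrt (by norm_num)
    have hZ : -(-1 : ℝ) ^ r * (27 / 5) / (Nat.fib r : ℝ) ^ 2 =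
        27 * -(-1 : ℝ) ^ r * x ^ 3 / (x ^ 3 + -(-1 : ℝ) ^ r) ^ 2 := by
      rw [← hfib, mul_pow, mul_pow, h5, hsq]
      field_simp
    -- Here $s=-(-1)^r$, and $F_r\ge1$ gives $|Z|\le27/5<27/4$.
    have hmain := hasSum_of_uniformizer
      (by rcases neg_one_pow_eq_or ℝ r with h | h <;> rw [h] <;> norm_num) hZ (Or.inr ⟨hone hr, by
        rw [abs_div, abs_mul, abs_neg, habs, one_mul, abs_of_pos (by norm_num : (0 : ℝ) < 27 / 5),
          abs_of_pos (by positivity), div_lt_iff₀ (by positivity)]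
        nlinarith⟩)
    rw [hfib]
    rw [sub_neg_eq_add, ← sub_eq_add_neg x] at hmain
    refine hmain.congr_fun fun k => ?_
    have hsign : (-1 : ℝ) ^ (((k : ℤ) + 1) * ((r : ℤ) - 1)) = (-(-1 : ℝ) ^ r) ^ (k + 1) := by
      rw [mul_comm, zpow_mul, zpow_sub_one₀ (by norm_num), zpow_natCast]
      norm_num [← zpow_natCast]
    rw [hsign, div_pow (-(-1 : ℝ) ^ r * (27 / 5)), mul_pow, ← pow_mul, tri]
    field_simp
  · intro hr
    have hluc := goldenRatio_pow_mul_lucas r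
    rw [← hcube] at hluc
    have hL : (0 : ℝ) < lucas r := by exact_mod_cast one_le_lucas r
    have hZ : (-1 : ℝ) ^ r * 27 / (lucas r : ℝ) ^ 2 =
        27 * (-1 : ℝ) ^ r * x ^ 3 / (x ^ 3 + (-1 : ℝ) ^ r) ^ 2 := by
      rw [← hluc, mul_pow, hsq]
      field_simp
    have hmain := hasSum_of_uniformizer (neg_one_pow_eq_or ℝ r) hZ (by
      -- For $r=0$, $L_0=2$ gives $Z=27/4$, the boundary case $x=s=1$; for $r\ge2$, $L_r\ge3$ gives
      -- $|Z|\le3$. The excluded $r=1$ would give $Z=-27$, outside the disc of convergence.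
      rcases Nat.eq_zero_or_pos r with h0 | h0
      · exact Or.inl ⟨hzero h0, by rw [h0, pow_zero]⟩
      · refine Or.inr ⟨hone h0.ne', ?_⟩
        have h3 : (3 : ℝ) ≤ lucas r := by
          obtain ⟨n, rfl⟩ := Nat.exists_eq_add_of_le' (show 2 ≤ r by omega)
          exact_mod_cast three_le_lucas n
        rw [abs_div, abs_mul, habs, one_mul, abs_of_pos (by norm_num : (0 : ℝ) < 27),
          abs_of_pos (by positivity), div_lt_iff₀ (by positivity)]
        nlinarith)
    rw [hluc]
    refine hmain.congr_fun fun k => ?_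
    rw [div_pow, mul_pow, ← pow_mul, ← pow_mul, tri, mul_comm r]
    field_simp
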